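/- Let $\mathcal X,\mathcal Y$ be Hilbert spaces over $\mathbb K\in\{\mathbb R,\mathbb C\}$, let $A:\mathcal X\to\mathcal Y$ be bounded and linear, and let $(e_i)_{i\in\mathbb N}$ be an orthonormal (Hilbert) basis of $\mathcal Y$; inner products are linear in the first argument. Let $\xi$ be a Gaussian white noise on $\mathcal Y$, that is, a linear map $\xi:\mathcal Y\to L^2(\Omega,P)$ on a probability space such that for all $h,h'\in\mathcal Y$: if $\mathbb K=\mathbb R$, then $\xi(h)\sim\mathcal N(0,\|h\|^2)$ and $\mathbb E[\xi(h)\xi(h')]=\langle h,h'\rangle$; if $\mathbb K=\mathbb C$, then $\xi(h)\sim\mathcal{CN}(0,2\|h\|^2)$ and $\mathbb E[\xi(h)\overline{\xi(h')}]=2\langle h,h'\rangle$ (here $\mathcal{CN}(0,2v)$ is the law of $X_1+iX_2$ with $X_1,X_2$ i.i.d. $\mathcal N(0,v)$). For $f\in\mathcal X$ and $\sigma>0$ let $\mathbb P_f=\mathbb P_{f,\sigma}$ be the law on $\mathbb K^{\mathbb N}$ of the data $y_\sigma=(\langle Af,e_i\rangle+\sigma\xi(e_i))_{i\in\mathbb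 N}$. Let $(u_k)_{k\in I}$ be a countable family in $\mathcal X$ and $(I_\sigma)_{\sigma>0}$ a family of finite subsets of $I$ with $Au_k\ne0$ for all $k\in I_\sigma$, $\sigma>0$. For $m\ge0$ put $$\mathcal F_\sigma(m)=\{\delta\|Au_k\|^{-1}u_k:\ k\in I_\sigma,\ \delta\in\mathbb K,\ |\delta|\ge m\},\qquad \gamma_\sigma(m)=\inf_{\phi}\Big[\mathbb P_0(\phi=1)+\sup_{f\in\mathcal F_\sigma(m)}\mathbb P_f(\phi=0)\Big],$$ the infimum running over all measurable $\phi:\mathbb K^{\mathbb N}\to\{0,1\}$. For families of real numbers write $a_\sigma\precsim b_\sigma$ (or $b_\sigma\succsim a_\sigma$) if there is $\sigma_0>0$ with $a_\sigma\le b_\sigma$ for all $0<\sigma<\sigma_0$. All limits are for $\sigma\to0$, and $\mu,\mu^L,\mu^U,\mu^*$ denote families of non-negative numbers indexed by $\sigma>0$. A family $\mu^*$ is called a minimax detection boundary if there are families $\mu^L,\mu^U$ with $\mu^L_\sigma/\mu^U_\sigma\to1$ and $\mu^L_\sigma\precsim\mu^*_\sigma\precsim\mu^U_\sigma$, such that $\gamma_\sigma(\mu_\sigma)\to0$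 whenever $\mu_\sigma\succsim\mu_\sigma^U$, and $\gamma_\sigma(\mu_\sigma)\to1$ whenever $\mu_\sigma\precsim\mu_\sigma^L$. **Theorem.** Let $$N_\sigma^*=\sup\{\#S:\ S\subseteq I_\sigma,\ \Re\langle Au_k,Au_{k'}\rangle\le0\text{ for any two distinct }k,k'\in S\}$$ and assume that $N_\sigma^*\to\infty$. Let $(\varepsilon_\sigma)_{\sigma>0}$ be positive numbers with $\varepsilon_\sigma\to0$ and $\varepsilon_\sigma\sqrt{\log N_\sigma^*}\to\infty$, and put $L_\sigma=(1-\varepsilon_\sigma)\sqrt{2\sigma^2\log N_\sigma^*}$. Then: 1. If $\mu_\sigma\precsim L_\sigma$, then $\gamma_\sigma(\mu_\sigma)\to1$. 2. Consequently $L$ is a lower bound for the detection threshold: if $\gamma_\sigma(\mu_\sigma)\to0$, then $\mu_\sigma\succsim L_\sigma$. Moreover, if $\mu^*$ is a minimax detection boundary, then $\mu^*_\sigma\succsim cL_\sigma$ for every real $c<1$, and $\max(\mu^*_\sigma,L_\sigma)$ is again a minimax detection boundary, so that a boundary can always be chosen with $\mu^*_\sigma\succsim L_\sigma$. -/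

import Mathlib

open MeasureTheory ProbabilityTheory Filter Topology
open scoped ENNReal NNReal

namespace SignalDetection

/-- The asymptotic order between families indexed by `σ > 0`:
there is `σ₀ > 0` with `a σ ≤ b σ` whenever `0 < σ < σ₀`. -/
def AsympLE (a b : ℝ → ℝ) : Prop :=
  ∃ σ₀ : ℝ, 0 < σ₀ ∧ ∀ σ : ℝ, 0 < σ → σ < σ₀ → a σ ≤ b σ

section Noise

/-- The centred Gaussian law on `𝕜 = ℝ` or `𝕜 = ℂ` with variance `v` in each real direction: the
law of `X₁ + X₂ * I` with `X₁, X₂` i.i.d. `N(0, v)`.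
For `𝕜 = ℝ` (where `RCLike.I = 0`) it is `N(0, v)`; for `𝕜 = ℂ` it is the
circular complex normal law `CN(0, 2 v)`. -/
noncomputable def scalarGaussian (𝕜 : Type*) [RCLike 𝕜] (v : ℝ≥0) : Measure 𝕜 :=
  ((gaussianReal 0 v).prod (gaussianReal 0 v)).map
    (fun p : ℝ × ℝ => (p.1 : 𝕜) + (p.2 : 𝕜) * RCLike.I)

theorem scalarGaussian_real (v : ℝ≥0) : scalarGaussian ℝ v = gaussianReal 0 v := by
  simp only [scalarGaussian, RCLike.I_to_real, mul_zero, add_zero, RCLike.ofReal_real_eq_id, id]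
  exact (measurePreserving_fst (μ := gaussianReal 0 v) (ν := gaussianReal 0 v)).map_eq

theorem scalarGaussian_complex (v : ℝ≥0) :
    scalarGaussian ℂ v =
      ((gaussianReal 0 v).prod (gaussianReal 0 v)).map (fun p : ℝ × ℝ => (⟨p.1, p.2⟩ : ℂ)) := by
  unfold scalarGaussian
  congr 1
  funext p
  apply Complex.ext <;> simp

variable {𝕜 : Type*} [RCLike 𝕜] {Y : Type*} [NormedAddCommGroup Y] [InnerProductSpace 𝕜 Y]
  {Ω : Type*} [MeasurableSpace Ω]

/-- Gaussian white noise on the Hilbert space `Y`: a linear map `ξ : Y → L²(Ω, P)` with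
* (real case) `ξ h ∼ N(0, ‖h‖²)` and `E (ξ h * ξ h') = ⟨h, h'⟩`;
* (complex case) `ξ h ∼ CN(0, 2 ‖h‖²)` and `E (ξ h * conj (ξ h')) = 2 ⟨h, h'⟩`.

The factor `1` or `2` is the real dimension of `𝕜`. The inner product `⟨h, h'⟩` that is linear in
its first argument is `inner 𝕜 h' h` in Mathlib's convention. -/
structure IsWhiteNoise (P : Measure Ω) (ξ : Y →ₗ[𝕜] Lp 𝕜 2 P) : Prop where
  hasLaw : ∀ h : Y, HasLaw (ξ h : Ω → 𝕜) (scalarGaussian 𝕜 (‖h‖₊ ^ 2)) P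
  covariance : ∀ h h' : Y,
    ∫ ω, ξ h ω * (starRingEnd 𝕜) (ξ h' ω) ∂P = (Module.finrank ℝ 𝕜 : 𝕜) * inner 𝕜 h' h

end Noise

section Testing

variable {𝕜 : Type*} [RCLike 𝕜]
  {X : Type*} [NormedAddCommGroup X] [InnerProductSpace 𝕜 X]
  {Y : Type*} [NormedAddCommGroup Y] [InnerProductSpace 𝕜 Y]
  {Ω : Type*} [MeasurableSpace Ω] {P : Measure Ω} {ι : Type*}

/-- The observation `Y_σ(h) = ⟨A f, h⟩ + σ ξ(h)` for the signal `f` at noise level `σ`. -/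
noncomputable def observation (A : X →L[𝕜] Y) (ξ : Y →ₗ[𝕜] Lp 𝕜 2 P) (σ : ℝ) (f : X)
    (h : Y) (ω : Ω) : 𝕜 :=
  inner 𝕜 h (A f) + (σ : 𝕜) * ξ h ω

/-- The law `ℙ_f` of the data sequence `y_σ = (Y_σ(e_i))_{i ∈ ℕ}` when `f` is the true signal. -/
noncomputable def dataLaw (A : X →L[𝕜] Y) (ξ : Y →ₗ[𝕜] Lp 𝕜 2 P) (e : HilbertBasis ℕ 𝕜 Y)
    (σ : ℝ) (f : X) : Measure (ℕ → 𝕜) :=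
  P.map (fun ω i => observation A ξ σ f (e i) ω)

/-- The alternative `F_σ(m) = {δ ‖A u_k‖⁻¹ u_k : k ∈ J, |δ| ≥ m}` with `J = I_σ`. -/
def alternatives (A : X →L[𝕜] Y) (u : ι → X) (J : Finset ι) (m : ℝ) : Set X :=
  {f | ∃ k ∈ J, ∃ δ : 𝕜, m ≤ ‖δ‖ ∧ f = δ • ((‖A (u k)‖⁻¹ : ℝ) : 𝕜) • u k}

/-- The minimax sum of errors at noise level `σ` for testing `f = 0` against `f ∈ F`: the infimum
over all tests `φ` (measurable maps from data sequences to `{0, 1}`, with value `1` meaning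
rejection of `f = 0`) of the type I error probability plus the largest type II error
probability. -/
noncomputable def minimaxError (A : X →L[𝕜] Y) (ξ : Y →ₗ[𝕜] Lp 𝕜 2 P) (e : HilbertBasis ℕ 𝕜 Y)
    (σ : ℝ) (F : Set X) : ℝ≥0∞ :=
  ⨅ (φ : (ℕ → 𝕜) → Fin 2) (_ : Measurable φ),
    dataLaw A ξ e σ 0 {y | φ y = 1} + ⨆ f ∈ F, dataLaw A ξ e σ f {y | φ y = 0}

/-- `γ_σ(μ_σ)` for the alternatives `F_σ(μ_σ)` built from `u_k`, `k ∈ I_σ`. -/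
noncomputable def gammaError (A : X →L[𝕜] Y) (ξ : Y →ₗ[𝕜] Lp 𝕜 2 P) (e : HilbertBasis ℕ 𝕜 Y)
    (u : ι → X) (I : ℝ → Finset ι) (μ : ℝ → ℝ) (σ : ℝ) : ℝ≥0∞ :=
  minimaxError A ξ e σ (alternatives A u (I σ) (μ σ))

/-- The largest size of a subset `S` of `J` such that `Re ⟨A u_k, A u_k'⟩ ≤ 0` for any two
distinct `k, k' ∈ S`. -/
noncomputable def maxNegCorrelated (A : X →L[𝕜] Y) (u : ι → X) (J : Finset ι) : ℕ :=
  sSup {n : ℕ | ∃ S : Finset ι, S ⊆ J ∧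
    (∀ k ∈ S, ∀ k' ∈ S, k ≠ k' → RCLike.re (inner 𝕜 (A (u k)) (A (u k'))) ≤ 0) ∧ S.card = n}

/-- `μstar` is an asymptotic minimax detection boundary: it lies between families `μL` and `μU`
with `μL σ / μU σ → 1`, such that `γ_σ(μ_σ) → 0` for every `μ` above `μU` and `γ_σ(μ_σ) → 1` for
every `μ` below `μL`. All the families consist of non-negative numbers. -/
def IsDetectionBoundary (A : X →L[𝕜] Y) (ξ : Y →ₗ[𝕜] Lp 𝕜 2 P) (e : HilbertBasis ℕ 𝕜 Y)
    (u : ι → X) (I : ℝ → Finset ι) (μstar : ℝ → ℝ) : Prop :=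
  (∀ σ, 0 < σ → 0 ≤ μstar σ) ∧
  ∃ μL μU : ℝ → ℝ, (∀ σ, 0 < σ → 0 ≤ μL σ) ∧ (∀ σ, 0 < σ → 0 ≤ μU σ) ∧
    (∀ μ : ℝ → ℝ, (∀ σ, 0 < σ → 0 ≤ μ σ) → AsympLE μU μ →
      Tendsto (gammaError A ξ e u I μ) (𝓝[>] 0) (𝓝 0)) ∧
    (∀ μ : ℝ → ℝ, (∀ σ, 0 < σ → 0 ≤ μ σ) → AsympLE μ μL →
      Tendsto (gammaError A ξ e u I μ) (𝓝[>] 0) (𝓝 1)) ∧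
    Tendsto (fun σ => μL σ / μU σ) (𝓝[>] 0) (𝓝 1) ∧
    AsympLE μL μstar ∧ AsympLE μstar μU

end Testing

/-- The threshold `(1 - ε_σ) √(2 σ² log N_σ)`. -/
noncomputable def lowerThreshold (ε : ℝ → ℝ) (N : ℝ → ℕ) (σ : ℝ) : ℝ :=
  (1 - ε σ) * √(2 * σ ^ 2 * Real.log (N σ))

end SignalDetection

/-! ### Gaussian laws and measures determined by one-dimensional projections -/

namespace SignalDetection

/-! Take `n = N σ` alternatives whose images are pairwise non-positively correlated, scaled to norm
`σ t` with `t = (1 - ε) T` and `T = √(2 log n)`. The worst type II error is at least the average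
one, so it suffices that the average of the `n` likelihood ratios is close to 1 in `L¹` under pure
noise.

By Cameron–Martin (`dataLaw_eq_map_tilted`) each ratio is `exp (Z_k - t² / 2)` with `Z_k ∼ N(0,
t²)`. Distinct ratios have mixed moment `exp (Re ⟨w_k, w_l⟩) ≤ 1`, but the diagonal contributes `exp
(t²) / n`, which is small only well below `√(log n)`. Truncating to `Z_k ≤ t T` repairs this: the
mean drops by at most `a = exp (-(T - t)² / 2)`, and the diagonal contributes at most `exp (t T - t²
/ 2) / n = a`. Since `(T - t)² / 2 = ε² log n → ∞`, the truncated average tends to 1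
(`integral_abs_one_sub_average_le`, `le_minimaxError`).

The remaining claims use that `γ` is antitone in the signal strength: a family with `γ → 0`
eventually dominates one with `γ → 1`. -/

theorem map_re_scalarGaussian (𝕜 : Type*) [RCLike 𝕜] (v : ℝ≥0) :
    (scalarGaussian 𝕜 v).map RCLike.re = gaussianReal 0 v := by
  have hm : Measurable (fun p : ℝ × ℝ => (p.1 : 𝕜) + (p.2 : 𝕜) * RCLike.I) := by fun_prop
  rw [scalarGaussian, Measure.map_map RCLike.measurable_re hm]
  have : (RCLike.re ∘ fun p : ℝ × ℝ => (p.1 : 𝕜) + (p.2 : 𝕜) * RCLike.I) = Prod.fst := by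
    funext p; simp
  rw [this]
  exact (measurePreserving_fst (μ := gaussianReal 0 v) (ν := gaussianReal 0 v)).map_eq

/-- Two random variables with the same moment generating function, finite everywhere, have the
same law. -/
theorem map_eq_map_of_mgf_eq {Ω Ω' : Type*} [MeasurableSpace Ω] [MeasurableSpace Ω']
    {P : Measure Ω} {P' : Measure Ω'} [IsProbabilityMeasure P] [IsProbabilityMeasure P']
    {X : Ω → ℝ} {Y : Ω' → ℝ} (hX : AEMeasurable X P) (hY : AEMeasurable Y P')
    (hint : ∀ t, Integrable (fun ω => Real.exp (t * X ω)) P) (h : mgf X P = mgf Y P') :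
    P.map X = P'.map Y := by
  refine Measure.ext_of_complexMGF_eq hX hY (funext fun z => eqOn_complexMGF_of_mgf h ?_)
  have : integrableExpSet X P = Set.univ := Set.eq_univ_of_forall hint
  simp [this]

/-- Finite measures on a separable Banach space that agree on all real one-dimensional
projections are equal. -/
theorem ext_of_map_dual {E : Type*} [NormedAddCommGroup E] [NormedSpace ℝ E] [CompleteSpace E]
    [MeasurableSpace E] [BorelSpace E] [SecondCountableTopology E] {μ ν : Measure E}
    [IsFiniteMeasure μ] [IsFiniteMeasure ν]
    (h : ∀ L : StrongDual ℝ E, μ.map L = ν.map L) : μ = ν := by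
  refine Measure.ext_of_charFunDual (funext fun L => ?_)
  rw [charFunDual_eq_charFun_map_one, charFunDual_eq_charFun_map_one, h L]

/-- Every real linear functional on `𝕜ˢ` is the real part of a `𝕜`-linear one. -/
theorem exists_re_sum_mul_eq {𝕜 : Type*} [RCLike 𝕜] {s : Type*} [Fintype s]
    (L : (s → 𝕜) →ₗ[ℝ] ℝ) : ∃ c : s → 𝕜, ∀ y, L y = RCLike.re (∑ i, c i * y i) := by
  classical
  -- For complex scalars `Re ((a - b I)(x + y I)) = a x + b y`; for real scalars `I = 0` and only `a
  -- x` remains.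
  refine ⟨fun i => (L (Pi.single i 1) : 𝕜) - (L (Pi.single i RCLike.I) : 𝕜) * RCLike.I,
    fun y => ?_⟩
  have hy : y = ∑ i, (RCLike.re (y i) • (Pi.single i 1 : s → 𝕜)
      + RCLike.im (y i) • (Pi.single i RCLike.I : s → 𝕜)) := by
    funext j
    simp only [Finset.sum_apply, Pi.add_apply, Pi.smul_apply, Pi.single_apply]
    rw [Finset.sum_eq_single j]
    · simp only [if_true, RCLike.real_smul_eq_coe_mul, mul_one]
      exact (RCLike.re_add_im _).symm
    · intro b _ hb
      simp [hb.symm]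
    · simp
  conv_lhs => rw [hy]
  rw [map_sum, map_sum]
  refine Finset.sum_congr rfl fun i _ => ?_
  rw [map_add, map_smul, map_smul]
  simp only [smul_eq_mul, RCLike.mul_re, map_sub, RCLike.ofReal_re, RCLike.ofReal_im, RCLike.I_re,
    RCLike.mul_im]
  rcases RCLike.I_eq_zero_or_im_I_eq_one (K := 𝕜) with h | h
  · simp [h, mul_comm]
  · rw [h]; ring

/-! ### Exponential moments and tilting of white noise -/

section

variable {𝕜 : Type*} [RCLike 𝕜] {Y : Type*} [NormedAddCommGroup Y] [InnerProductSpace 𝕜 Y]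
  {Ω : Type*} [MeasurableSpace Ω] {P : Measure Ω}

/-- The real part of the noise variable `ξ h`. -/
noncomputable def noiseRe (ξ : Y →ₗ[𝕜] Lp 𝕜 2 P) (h : Y) (ω : Ω) : ℝ := RCLike.re (ξ h ω)

theorem measurable_noise (ξ : Y →ₗ[𝕜] Lp 𝕜 2 P) (h : Y) : Measurable (ξ h : Ω → 𝕜) :=
  (Lp.stronglyMeasurable (ξ h)).measurable

theorem measurable_noiseRe (ξ : Y →ₗ[𝕜] Lp 𝕜 2 P) (h : Y) : Measurable (noiseRe ξ h) :=
  RCLike.measurable_re.comp (measurable_noise ξ h)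

theorem noise_sum_smul (ξ : Y →ₗ[𝕜] Lp 𝕜 2 P) {s : Type*} (t : Finset s) (c : s → 𝕜)
    (f : s → Y) : ∀ᵐ ω ∂P, ξ (∑ i ∈ t, c i • f i) ω = ∑ i ∈ t, c i * ξ (f i) ω := by
  classical
  induction t using Finset.induction_on with
  | empty =>
    simp only [Finset.sum_empty, map_zero]
    exact Lp.coeFn_zero 𝕜 2 P
  | insert a t ha ih =>
    rw [Finset.sum_insert ha, map_add, map_smul]
    filter_upwards [ih, Lp.coeFn_add (c a • ξ (f a)) (ξ (∑ i ∈ t, c i • f i)),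
      Lp.coeFn_smul (c a) (ξ (f a))] with ω h1 h2 h3
    rw [h2, Pi.add_apply, h3, h1, Finset.sum_insert ha, Pi.smul_apply, smul_eq_mul]

theorem noiseRe_lincomb (ξ : Y →ₗ[𝕜] Lp 𝕜 2 P) (h w : Y) (t : ℝ) :
    ∀ᵐ ω ∂P, noiseRe ξ (w + (t : 𝕜) • h) ω = noiseRe ξ w ω + t * noiseRe ξ h ω := by
  simp only [noiseRe, map_add, map_smul]
  filter_upwards [Lp.coeFn_add (ξ w) ((t : 𝕜) • ξ h), Lp.coeFn_smul (t : 𝕜) (ξ h)] with ω h2 h3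
  rw [h2, Pi.add_apply, h3]
  simp

namespace IsWhiteNoise

variable {ξ : Y →ₗ[𝕜] Lp 𝕜 2 P}

theorem map_noiseRe (hξ : IsWhiteNoise P ξ) (h : Y) :
    P.map (noiseRe ξ h) = gaussianReal 0 (‖h‖₊ ^ 2) := by
  have := (hξ.hasLaw h).map_eq
  rw [← map_re_scalarGaussian 𝕜, ← this,
    Measure.map_map RCLike.measurable_re (measurable_noise ξ h)]
  rfl

theorem integral_exp_noiseRe (hξ : IsWhiteNoise P ξ) (h : Y) :
    ∫ ω, Real.exp (noiseRe ξ h ω) ∂P = Real.exp (‖h‖ ^ 2 / 2) := by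
  have := mgf_gaussianReal (hξ.map_noiseRe h) 1
  simpa [mgf] using this

theorem integrable_exp_noiseRe (hξ : IsWhiteNoise P ξ) (h : Y) :
    Integrable (fun ω => Real.exp (noiseRe ξ h ω)) P := by
  refine Integrable.of_integral_ne_zero ?_
  rw [hξ.integral_exp_noiseRe]
  exact (Real.exp_pos _).ne'

theorem integrable_exp_add_noiseRe (hξ : IsWhiteNoise P ξ) (h w : Y) (t : ℝ) :
    Integrable (fun ω => Real.exp (noiseRe ξ w ω + t * noiseRe ξ h ω)) P := by
  refine (hξ.integrable_exp_noiseRe (w + (t : 𝕜) • h)).congr ?_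
  filter_upwards [noiseRe_lincomb ξ h w t] with ω hω
  rw [hω]

theorem integral_exp_add_noiseRe (hξ : IsWhiteNoise P ξ) (h w : Y) (t : ℝ) :
    ∫ ω, Real.exp (noiseRe ξ w ω + t * noiseRe ξ h ω) ∂P
      = Real.exp (‖w‖ ^ 2 / 2 + t * RCLike.re (inner 𝕜 h w) + t ^ 2 * ‖h‖ ^ 2 / 2) := by
  have h1 : ∫ ω, Real.exp (noiseRe ξ w ω + t * noiseRe ξ h ω) ∂P
      = ∫ ω, Real.exp (noiseRe ξ (w + (t : 𝕜) • h) ω) ∂P := by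
    refine integral_congr_ae ?_
    filter_upwards [noiseRe_lincomb ξ h w t] with ω hω
    rw [hω]
  rw [h1, hξ.integral_exp_noiseRe, norm_add_sq (𝕜 := 𝕜), inner_smul_right, RCLike.re_ofReal_mul,
    norm_smul, RCLike.norm_ofReal, mul_pow, sq_abs, inner_re_symm]
  congr 1
  ring

variable [IsProbabilityMeasure P]

/-- One-dimensional Cameron–Martin: the cross term `t * Re ⟨h, w⟩` in the exponential moment of `ξ w
+ t ξ h` is exactly the effect of a shift, so both sides have the same moment generating function.
-/
theorem map_tilted_noiseRe (hξ : IsWhiteNoise P ξ) (h w : Y) :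
    (P.tilted (noiseRe ξ w)).map (noiseRe ξ h)
      = P.map (fun ω => RCLike.re (inner 𝕜 h w) + noiseRe ξ h ω) := by
  have := isProbabilityMeasure_tilted (hξ.integrable_exp_noiseRe w)
  have hm := measurable_noiseRe ξ h
  -- Inserting the null variable `ξ 0` makes the untilted moment the case `w = 0` of the same
  -- formula.
  have h0 : ∀ᵐ ω ∂P, noiseRe ξ (0 : Y) ω = 0 := by
    filter_upwards [Lp.coeFn_zero 𝕜 2 P] with ω hω
    rw [noiseRe, map_zero, hω, Pi.zero_apply, map_zero]
  have hexp (t : ℝ) : (fun ω => Real.exp (t * (RCLike.re (inner 𝕜 h w) + noiseRe ξ h ω)))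
      =ᵐ[P] fun ω => Real.exp (t * RCLike.re (inner 𝕜 h w))
        * Real.exp (noiseRe ξ 0 ω + t * noiseRe ξ h ω) := by
    filter_upwards [h0] with ω hω
    rw [hω, ← Real.exp_add]
    congr 1; ring
  refine (map_eq_map_of_mgf_eq (by fun_prop) hm.aemeasurable (fun t => ?_) ?_).symm
  · exact ((hξ.integrable_exp_add_noiseRe h 0 t).const_mul _).congr (hexp t).symm
  · funext t
    rw [mgf, mgf, integral_exp_tilted, integral_congr_ae (hexp t), integral_const_mul,
      hξ.integral_exp_add_noiseRe, hξ.integral_exp_noiseRe]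
    simp only [Pi.add_apply]
    rw [hξ.integral_exp_add_noiseRe h w t, ← Real.exp_add, ← Real.exp_sub]
    congr 1
    simp
    ring

end IsWhiteNoise
end

/-! ### Coordinatewise conjugation -/

section

variable {𝕜 : Type*} [RCLike 𝕜] {Y : Type*} [NormedAddCommGroup Y] [InnerProductSpace 𝕜 Y]

/-- Complex conjugation of the coordinates with respect to a Hilbert basis. -/
noncomputable def conjVec (e : HilbertBasis ℕ 𝕜 Y) (v : Y) : Y := e.repr.symm (star (e.repr v))

/-- The log-likelihood involves `Re ∑ conj(a_i) ξ(e_i)`, where `a_i` are the coordinates of the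
signal. As `ξ` is linear, this is the noise in the conjugated direction. -/
theorem inner_basis_conjVec (e : HilbertBasis ℕ 𝕜 Y) (v : Y) (i : ℕ) :
    inner 𝕜 (e i) (conjVec e v) = (starRingEnd 𝕜) (inner 𝕜 (e i) v) := by
  rw [← e.repr_apply_apply, ← e.repr_apply_apply, conjVec, LinearIsometryEquiv.apply_symm_apply,
    lp.star_apply]
  rfl

theorem inner_conjVec (e : HilbertBasis ℕ 𝕜 Y) (v w : Y) :
    inner 𝕜 (conjVec e v) (conjVec e w) = (starRingEnd 𝕜) (inner 𝕜 v w) := by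
  rw [← e.repr.inner_map_map, ← e.repr.inner_map_map v w, lp.inner_eq_tsum, lp.inner_eq_tsum,
    RCLike.conj_tsum]
  refine tsum_congr fun i => ?_
  simp only [conjVec, LinearIsometryEquiv.apply_symm_apply, lp.star_apply, RCLike.inner_apply,
    map_mul, RCLike.star_def]

theorem norm_conjVec (e : HilbertBasis ℕ 𝕜 Y) (v : Y) : ‖conjVec e v‖ = ‖v‖ := by
  rw [conjVec, LinearIsometryEquiv.norm_map, norm_star, LinearIsometryEquiv.norm_map]

end

/-! ### Cameron–Martin formula for the data sequence -/

section

variable {𝕜 : Type*} [RCLike 𝕜] {X : Type*} [NormedAddCommGroup X] [InnerProductSpace 𝕜 X]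
  {Y : Type*} [NormedAddCommGroup Y] [InnerProductSpace 𝕜 Y]
  {Ω : Type*} [MeasurableSpace Ω] {P : Measure Ω}

/-- The pure noise data sequence `σ ξ(e_i)`. -/
noncomputable def noiseData (ξ : Y →ₗ[𝕜] Lp 𝕜 2 P) (e : HilbertBasis ℕ 𝕜 Y) (σ : ℝ)
    (ω : Ω) (i : ℕ) : 𝕜 := (σ : 𝕜) * ξ (e i) ω

theorem measurable_noiseData (ξ : Y →ₗ[𝕜] Lp 𝕜 2 P) (e : HilbertBasis ℕ 𝕜 Y) (σ : ℝ) :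
    Measurable (noiseData ξ e σ) :=
  measurable_pi_lambda _ fun i => (measurable_noise ξ (e i)).const_mul _

theorem measurable_observation (A : X →L[𝕜] Y) (ξ : Y →ₗ[𝕜] Lp 𝕜 2 P) (e : HilbertBasis ℕ 𝕜 Y)
    (σ : ℝ) (f : X) : Measurable (fun ω i => observation A ξ σ f (e i) ω) :=
  measurable_pi_lambda _ fun i => ((measurable_noise ξ (e i)).const_mul _).const_add _

theorem dataLaw_zero (A : X →L[𝕜] Y) (ξ : Y →ₗ[𝕜] Lp 𝕜 2 P) (e : HilbertBasis ℕ 𝕜 Y) (σ : ℝ) :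
    dataLaw A ξ e σ 0 = P.map (noiseData ξ e σ) := by
  simp only [dataLaw, observation, map_zero, inner_zero_right, zero_add]
  rfl

/-- Cameron–Martin: the law of the data with signal `f` is the law of the pure noise data under
an exponentially tilted measure. -/
theorem dataLaw_eq_map_tilted [IsProbabilityMeasure P] (A : X →L[𝕜] Y) {ξ : Y →ₗ[𝕜] Lp 𝕜 2 P}
    (hξ : IsWhiteNoise P ξ) (e : HilbertBasis ℕ 𝕜 Y) {σ : ℝ} (hσ : σ ≠ 0) (f : X) :
    dataLaw A ξ e σ f
      = (P.tilted (noiseRe ξ (((σ⁻¹ : ℝ) : 𝕜) • conjVec e (A f)))).map (noiseData ξ e σ) := by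
  set w := ((σ⁻¹ : ℝ) : 𝕜) • conjVec e (A f) with hw
  have := isProbabilityMeasure_tilted (hξ.integrable_exp_noiseRe w)
  have hobs := measurable_observation A ξ e σ f
  have hnoise := measurable_noiseData ξ e σ
  have : IsProbabilityMeasure (dataLaw A ξ e σ f) :=
    Measure.isProbabilityMeasure_map hobs.aemeasurable
  have : IsProbabilityMeasure ((P.tilted (noiseRe ξ w)).map (noiseData ξ e σ)) :=
    Measure.isProbabilityMeasure_map hnoise.aemeasurable
  -- A finite measure on sequences is determined by its finite-dimensional marginals, and these by
  -- their real linear projections, each of which is the real part of noise in a single direction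
  -- `h`.
  refine IsProjectiveLimit.unique (P := fun J => (dataLaw A ξ e σ f).map J.restrict)
    (fun J => rfl) (fun J => ?_)
  have hJ : Measurable (J.restrict : (ℕ → 𝕜) → (J → 𝕜)) := Finset.measurable_restrict J
  have : IsProbabilityMeasure ((dataLaw A ξ e σ f).map J.restrict) :=
    Measure.isProbabilityMeasure_map hJ.aemeasurable
  have : IsProbabilityMeasure
      (((P.tilted (noiseRe ξ w)).map (noiseData ξ e σ)).map J.restrict) :=
    Measure.isProbabilityMeasure_map hJ.aemeasurable
  refine ext_of_map_dual (E := J → 𝕜) fun L => ?_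
  obtain ⟨c, hc⟩ := exists_re_sum_mul_eq (L : (J → 𝕜) →ₗ[ℝ] ℝ)
  have hL : Measurable L := L.continuous.measurable
  beta_reduce
  rw [dataLaw, Measure.map_map hJ hnoise, Measure.map_map hL (hJ.comp hnoise),
    Measure.map_map hJ hobs, Measure.map_map hL (hJ.comp hobs)]
  set h : Y := ∑ i : J, (c i * (σ : 𝕜)) • e i with hh
  have hsum : ∀ᵐ ω ∂P, noiseRe ξ h ω = RCLike.re (∑ i : J, c i * ((σ : 𝕜) * ξ (e i) ω)) := by
    filter_upwards [noise_sum_smul ξ Finset.univ (fun i : J => c i * (σ : 𝕜)) (fun i => e i)]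
      with ω hω
    rw [noiseRe, hh, hω]
    simp only [mul_assoc]
  have hdrift : RCLike.re (inner 𝕜 h w)
      = RCLike.re (∑ i : J, c i * inner 𝕜 (e i) (A f)) := by
    rw [← RCLike.conj_re, hh, sum_inner, map_sum]
    congr 1
    refine Finset.sum_congr rfl fun i _ => ?_
    rw [hw, inner_smul_left, inner_smul_right, inner_basis_conjVec]
    simp only [map_mul, map_inv₀, RCLike.conj_conj, RCLike.conj_ofReal]
    have : (σ : 𝕜) ≠ 0 := by exact_mod_cast hσ
    field_simp
  have h1 : (L ∘ J.restrict ∘ noiseData ξ e σ) =ᵐ[P.tilted (noiseRe ξ w)] noiseRe ξ h := by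
    filter_upwards [(tilted_absolutelyContinuous P (noiseRe ξ w)).ae_le hsum] with ω hω
    rw [hω]
    exact hc _
  have h2 : (L ∘ J.restrict ∘ fun ω i => observation A ξ σ f (e i) ω)
      =ᵐ[P] fun ω => RCLike.re (inner 𝕜 h w) + noiseRe ξ h ω := by
    filter_upwards [hsum] with ω hω
    rw [hω, hdrift, ← map_add, ← Finset.sum_add_distrib]
    refine (hc _).trans ?_
    congr 1
    exact Finset.sum_congr rfl fun i _ => mul_add _ _ _
  rw [Measure.map_congr h1, Measure.map_congr h2, hξ.map_tilted_noiseRe h w]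

end

/-! ### Second-moment method for truncated likelihood ratios -/

/-- A random variable with mean at least `1 - a` and second moment at most `1 + a` is close to one
in `L¹`. -/
theorem integral_abs_one_sub_le_sqrt {Ω : Type*} [MeasurableSpace Ω] {P : Measure Ω}
    [IsProbabilityMeasure P] {V : Ω → ℝ} {a : ℝ} (ha : 0 < a) (hV : MemLp V 2 P)
    (h1 : 1 - a ≤ ∫ ω, V ω ∂P) (h2 : ∫ ω, V ω ^ 2 ∂P ≤ 1 + a) :
    ∫ ω, |1 - V ω| ∂P ≤ √(3 * a) := by
  have hVi : Integrable V P := hV.integrable (by norm_num)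
  have hV2 : Integrable (fun ω => V ω ^ 2) P := hV.integrable_sq
  set s := √(3 * a) with hs
  have hs0 : 0 < s := Real.sqrt_pos.2 (by positivity)
  have hss : s ^ 2 = 3 * a := Real.sq_sqrt (by positivity)
  -- The integrand dominates `|1 - V|` by `x ≤ x² / (2 s) + s / 2`, and `E (1 - V)² ≤ 1 - 2 (1 - a)
  -- + (1 + a) = 3 a = s²`.
  have hint : ∫ ω, ((1 - 2 * V ω + V ω ^ 2) / (2 * s) + s / 2) ∂P ≤ s := by
    have e1 : Integrable (fun ω => 1 - 2 * V ω) P := (integrable_const _).sub (hVi.const_mul 2)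
    have e2 : Integrable (fun ω => 1 - 2 * V ω + V ω ^ 2) P := e1.add hV2
    rw [integral_add (e2.div_const _) (integrable_const _), integral_div,
      integral_add e1 hV2, integral_sub (integrable_const _) (hVi.const_mul 2),
      integral_const_mul]
    simp only [integral_const, probReal_univ, one_smul]
    have : (1 - 2 * ∫ ω, V ω ∂P + ∫ ω, V ω ^ 2 ∂P) / (2 * s) ≤ s / 2 := by
      rw [div_le_div_iff₀ (by positivity) (by norm_num)]
      nlinarith
    linarith
  refine (integral_mono (((integrable_const 1).sub hVi).abs) ?_ fun ω => ?_).trans hint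
  · exact ((((integrable_const _).sub (hVi.const_mul 2)).add hV2).div_const _).add
      (integrable_const _)
  · change |1 - V ω| ≤ (1 - 2 * V ω + V ω ^ 2) / (2 * s) + s / 2
    have h3 : 1 - 2 * V ω + V ω ^ 2 = |1 - V ω| ^ 2 := by rw [sq_abs]; ring
    rw [h3, div_add_div _ _ (by positivity) (by norm_num), le_div_iff₀ (by positivity)]
    nlinarith [sq_nonneg (|1 - V ω| - s)]

section

variable {𝕜 : Type*} [RCLike 𝕜] {Y : Type*} [NormedAddCommGroup Y] [InnerProductSpace 𝕜 Y]
  {Ω : Type*} [MeasurableSpace Ω] {P : Measure Ω}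

/-- The likelihood ratio of the shift by `w`, truncated where the noise in direction `w`
exceeds `b`. -/
noncomputable def truncatedRatio (ξ : Y →ₗ[𝕜] Lp 𝕜 2 P) (b : ℝ) (w : Y) (ω : Ω) : ℝ :=
  if noiseRe ξ w ω ≤ b then Real.exp (noiseRe ξ w ω) / Real.exp (‖w‖ ^ 2 / 2) else 0

variable (ξ : Y →ₗ[𝕜] Lp 𝕜 2 P) (b : ℝ) (w : Y)

theorem measurable_truncatedRatio : Measurable (truncatedRatio ξ b w) := by
  have := measurable_noiseRe ξ w
  exact Measurable.ite (measurableSet_le this measurable_const) (by fun_prop) measurable_const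

theorem truncatedRatio_nonneg (ω : Ω) : 0 ≤ truncatedRatio ξ b w ω := by
  unfold truncatedRatio
  split_ifs <;> positivity

theorem truncatedRatio_le (ω : Ω) :
    truncatedRatio ξ b w ω ≤ Real.exp (noiseRe ξ w ω) / Real.exp (‖w‖ ^ 2 / 2) := by
  unfold truncatedRatio
  split_ifs
  · rfl
  · positivity

theorem truncatedRatio_le_exp (ω : Ω) : truncatedRatio ξ b w ω ≤ Real.exp (b - ‖w‖ ^ 2 / 2) := by
  unfold truncatedRatio
  split_ifs with h
  · rw [← Real.exp_sub]
    gcongr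
  · positivity

theorem memLp_truncatedRatio [IsFiniteMeasure P] (p : ℝ≥0∞) :
    MemLp (truncatedRatio ξ b w) p P := by
  refine MemLp.of_bound (measurable_truncatedRatio ξ b w).aestronglyMeasurable
    (Real.exp (b - ‖w‖ ^ 2 / 2)) (ae_of_all _ fun ω => ?_)
  rw [Real.norm_of_nonneg (truncatedRatio_nonneg ξ b w ω)]
  exact truncatedRatio_le_exp ξ b w ω

theorem integrable_truncatedRatio [IsFiniteMeasure P] : Integrable (truncatedRatio ξ b w) P :=
  memLp_one_iff_integrable.1 (memLp_truncatedRatio ξ b w 1)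

theorem integrable_truncatedRatio_mul [IsFiniteMeasure P] (w' : Y) :
    Integrable (fun ω => truncatedRatio ξ b w ω * truncatedRatio ξ b w' ω) P :=
  (memLp_truncatedRatio ξ b w 2).integrable_mul (memLp_truncatedRatio ξ b w' 2)

variable {ξ b w} [IsProbabilityMeasure P]

theorem IsWhiteNoise.integral_truncatedRatio_le (hξ : IsWhiteNoise P ξ) :
    ∫ ω, truncatedRatio ξ b w ω ∂P ≤ 1 := by
  refine (integral_mono (integrable_truncatedRatio ξ b w)
    ((hξ.integrable_exp_noiseRe w).div_const _) (truncatedRatio_le ξ b w)).trans ?_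
  rw [integral_div, hξ.integral_exp_noiseRe, div_self (Real.exp_pos _).ne']

/-- The mass lost by truncation is a Gaussian tail under the shifted law, controlled by Chernoff's
bound. -/
theorem IsWhiteNoise.le_integral_truncatedRatio (hξ : IsWhiteNoise P ξ) {T : ℝ} (hw : 0 < ‖w‖)
    (hT : ‖w‖ ≤ T) :
    1 - Real.exp (-(T - ‖w‖) ^ 2 / 2) ≤ ∫ ω, truncatedRatio ξ (‖w‖ * T) w ω ∂P := by
  set t := ‖w‖ with ht
  -- The optimal Chernoff exponent: it minimises `(1 + s)² t² / 2 - t² / 2 - s t T`, with minimum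
  -- `-(T - t)² / 2`.
  set s : ℝ := (T - t) / t with hs
  have hs0 : 0 ≤ s := div_nonneg (by linarith) hw.le
  have i1 := (hξ.integrable_exp_noiseRe w).div_const (Real.exp (t ^ 2 / 2))
  have i2 := (hξ.integrable_exp_add_noiseRe w w s).mul_const (Real.exp (-(t ^ 2 / 2) - s * (t * T)))
  have hval : ∫ ω, (Real.exp (noiseRe ξ w ω) / Real.exp (t ^ 2 / 2)
      - Real.exp (noiseRe ξ w ω + s * noiseRe ξ w ω)
        * Real.exp (-(t ^ 2 / 2) - s * (t * T))) ∂P = 1 - Real.exp (-(T - t) ^ 2 / 2) := by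
    rw [integral_sub i1 i2, integral_div, integral_mul_const, hξ.integral_exp_noiseRe,
      hξ.integral_exp_add_noiseRe, div_self (Real.exp_pos _).ne', ← Real.exp_add,
      inner_self_eq_norm_sq, ← ht]
    congr 2
    rw [hs]
    field_simp
    ring
  rw [← hval]
  refine integral_mono (i1.sub i2) (integrable_truncatedRatio ξ _ w) fun ω => ?_
  simp only [truncatedRatio]
  split_ifs with h
  · have := Real.exp_pos (noiseRe ξ w ω + s * noiseRe ξ w ω)
    have := Real.exp_pos (-(t ^ 2 / 2) - s * (t * T))
    have := mul_pos ‹0 < Real.exp (noiseRe ξ w ω + s * noiseRe ξ w ω)› this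
    linarith
  · rw [← Real.exp_sub, ← Real.exp_add, sub_nonpos, Real.exp_le_exp]
    push Not at h
    nlinarith [mul_le_mul_of_nonneg_left h.le hs0]

theorem IsWhiteNoise.integral_truncatedRatio_mul_le (hξ : IsWhiteNoise P ξ) {w' : Y}
    (h : RCLike.re (inner 𝕜 w w') ≤ 0) :
    ∫ ω, truncatedRatio ξ b w ω * truncatedRatio ξ b w' ω ∂P ≤ 1 := by
  have i2 := (hξ.integrable_exp_add_noiseRe w w' 1).mul_const
    (Real.exp (-(‖w‖ ^ 2 / 2) - ‖w'‖ ^ 2 / 2))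
  refine (integral_mono (integrable_truncatedRatio_mul ξ b w w') i2 fun ω => ?_).trans ?_
  · refine (mul_le_mul (truncatedRatio_le ξ b w ω) (truncatedRatio_le ξ b w' ω)
      (truncatedRatio_nonneg _ _ _ _) (by positivity)).trans_eq ?_
    rw [← Real.exp_sub, ← Real.exp_sub, ← Real.exp_add, ← Real.exp_add]
    congr 1; ring
  · rw [integral_mul_const, hξ.integral_exp_add_noiseRe, ← Real.exp_add, Real.exp_le_one_iff]
    linarith

/-- Bounding one factor by its maximum and the other by its mean avoids the untruncated second
moment `exp (‖w‖²)`. -/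
theorem IsWhiteNoise.integral_truncatedRatio_mul_self_le (hξ : IsWhiteNoise P ξ) :
    ∫ ω, truncatedRatio ξ b w ω * truncatedRatio ξ b w ω ∂P ≤ Real.exp (b - ‖w‖ ^ 2 / 2) := by
  calc _ ≤ ∫ ω, Real.exp (b - ‖w‖ ^ 2 / 2) * truncatedRatio ξ b w ω ∂P := by
        refine integral_mono (integrable_truncatedRatio_mul ξ b w w)
          ((integrable_truncatedRatio ξ b w).const_mul _) fun ω => ?_
        exact mul_le_mul_of_nonneg_right (truncatedRatio_le_exp ξ b w ω)
          (truncatedRatio_nonneg _ _ _ _)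
    _ ≤ _ := by
        rw [integral_const_mul]
        exact mul_le_of_le_one_right (Real.exp_pos _).le hξ.integral_truncatedRatio_le

/-- The average of the truncated likelihood ratios in non-positively correlated directions of
length `t ≤ T = √(2 log n)` is close to one in mean. -/
theorem IsWhiteNoise.integral_abs_one_sub_average_le (hξ : IsWhiteNoise P ξ) {ι : Type*}
    {S : Finset ι} {w : ι → Y} {t T : ℝ} (ht : 0 < t) (htT : t ≤ T)
    (hT : Real.exp (T ^ 2 / 2) = S.card) (hw : ∀ k ∈ S, ‖w k‖ = t)
    (hcorr : ∀ k ∈ S, ∀ l ∈ S, k ≠ l → RCLike.re (inner 𝕜 (w k) (w l)) ≤ 0) :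
    ∫ ω, |1 - (S.card : ℝ)⁻¹ * ∑ k ∈ S, truncatedRatio ξ (t * T) (w k) ω| ∂P
      ≤ √(3 * Real.exp (-(T - t) ^ 2 / 2)) := by
  classical
  set a := Real.exp (-(T - t) ^ 2 / 2) with ha
  have hn : (0 : ℝ) < S.card := hT ▸ Real.exp_pos _
  refine integral_abs_one_sub_le_sqrt (Real.exp_pos _)
    ((memLp_finsetSum S fun k _ => memLp_truncatedRatio ξ (t * T) (w k) 2).const_mul _) ?_ ?_
  · rw [integral_const_mul, integral_finsetSum S fun k _ => integrable_truncatedRatio ξ _ (w k),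
      inv_mul_eq_div, le_div_iff₀ hn, mul_comm, ← nsmul_eq_mul]
    refine Finset.card_nsmul_le_sum _ _ _ fun k hk => ?_
    have := hξ.le_integral_truncatedRatio (w := w k) (T := T) (by rw [hw k hk]; exact ht)
      (by rw [hw k hk]; exact htT)
    rwa [hw k hk] at this
  · have hsq : (fun ω => ((S.card : ℝ)⁻¹ * ∑ k ∈ S, truncatedRatio ξ (t * T) (w k) ω) ^ 2)
        = fun ω => ((S.card : ℝ)⁻¹) ^ 2 * ∑ k ∈ S, ∑ l ∈ S,
          truncatedRatio ξ (t * T) (w k) ω * truncatedRatio ξ (t * T) (w l) ω := by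
      funext ω
      rw [mul_pow, sq (∑ k ∈ S, _), Finset.sum_mul_sum]
    rw [hsq, integral_const_mul, integral_finsetSum S fun k _ => integrable_finsetSum S
      fun l _ => integrable_truncatedRatio_mul ξ _ (w k) (w l)]
    have hrow : ∀ k ∈ S, ∫ ω, ∑ l ∈ S,
        truncatedRatio ξ (t * T) (w k) ω * truncatedRatio ξ (t * T) (w l) ω ∂P
          ≤ S.card * a + S.card := by
      intro k hk
      rw [integral_finsetSum S fun l _ => integrable_truncatedRatio_mul ξ _ (w k) (w l),
        ← Finset.add_sum_erase S _ hk]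
      refine add_le_add ?_ ?_
      -- Diagonal term: `t T - t² / 2 = T² / 2 - (T - t)² / 2`, and `exp (T² / 2)` is the
      -- cardinality.
      · refine hξ.integral_truncatedRatio_mul_self_le.trans_eq ?_
        rw [hw k hk, ← hT, ha, ← Real.exp_add]
        congr 1; ring
      · refine (Finset.sum_le_card_nsmul _ _ 1 fun l hl => ?_).trans ?_
        · exact hξ.integral_truncatedRatio_mul_le
            (hcorr k hk l (Finset.mem_of_mem_erase hl) (Finset.ne_of_mem_erase hl).symm)
        · rw [nsmul_eq_mul, mul_one]
          exact_mod_cast Finset.card_erase_le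
    have := Finset.sum_le_card_nsmul _ _ _ hrow
    rw [nsmul_eq_mul] at this
    calc _ ≤ ((S.card : ℝ)⁻¹) ^ 2 * (S.card * (S.card * a + S.card)) := by gcongr
      _ = 1 + a := by field_simp; ring

end

/-! ### From likelihood ratios to the minimax error -/

section

variable {𝕜 : Type*} [RCLike 𝕜] {X : Type*} [NormedAddCommGroup X] [InnerProductSpace 𝕜 X]
  {Y : Type*} [NormedAddCommGroup Y] [InnerProductSpace 𝕜 Y]
  {Ω : Type*} [MeasurableSpace Ω] {P : Measure Ω} [IsProbabilityMeasure P]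

/-- Lower bound for the minimax error of testing against alternatives that contain `n` signals
with non-positively correlated images of norm `σ t`, `t ≤ T = √(2 log n)`. -/
theorem IsWhiteNoise.le_minimaxError {ξ : Y →ₗ[𝕜] Lp 𝕜 2 P} (hξ : IsWhiteNoise P ξ)
    (A : X →L[𝕜] Y) (e : HilbertBasis ℕ 𝕜 Y) {σ : ℝ} (hσ : 0 < σ) {F : Set X} {ι : Type*}
    {S : Finset ι} {f : ι → X} {t T : ℝ} (ht : 0 < t) (htT : t ≤ T)
    (hT : Real.exp (T ^ 2 / 2) = S.card) (hfF : ∀ k ∈ S, f k ∈ F)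
    (hf : ∀ k ∈ S, ‖A (f k)‖ = σ * t)
    (hcorr : ∀ k ∈ S, ∀ l ∈ S, k ≠ l → RCLike.re (inner 𝕜 (A (f k)) (A (f l))) ≤ 0) :
    ENNReal.ofReal (1 - √(3 * Real.exp (-(T - t) ^ 2 / 2))) ≤ minimaxError A ξ e σ F := by
  refine le_iInf₂ fun φ hφ => ?_
  have hφm (i : Fin 2) : MeasurableSet {y | φ y = i} := hφ (measurableSet_singleton i)
  have hn : (0 : ℝ) < S.card := hT ▸ Real.exp_pos _
  have hS : S.Nonempty := Finset.card_pos.1 (by exact_mod_cast hn)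
  set w : ι → Y := fun k => ((σ⁻¹ : ℝ) : 𝕜) • conjVec e (A (f k)) with hwdef
  have hw : ∀ k ∈ S, ‖w k‖ = t := fun k hk => by
    simp only [hwdef]
    rw [norm_smul, RCLike.norm_ofReal, norm_conjVec, hf k hk, abs_of_pos (inv_pos.2 hσ),
      inv_mul_cancel_left₀ hσ.ne']
  have hwcorr : ∀ k ∈ S, ∀ l ∈ S, k ≠ l → RCLike.re (inner 𝕜 (w k) (w l)) ≤ 0 := by
    intro k hk l hl hkl
    simp only [hwdef]
    rw [inner_smul_left, inner_smul_right, inner_conjVec, RCLike.conj_ofReal,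
      RCLike.re_ofReal_mul, RCLike.re_ofReal_mul, RCLike.conj_re]
    have := hcorr k hk l hl hkl
    have hi := inv_pos.2 hσ
    exact mul_nonpos_of_nonneg_of_nonpos hi.le (mul_nonpos_of_nonneg_of_nonpos hi.le this)
  have hmain := hξ.integral_abs_one_sub_average_le ht htT hT hw hwcorr
  set W : ι → Ω → ℝ := fun k => truncatedRatio ξ (t * T) (w k) with hW
  set r := √(3 * Real.exp (-(T - t) ^ 2 / 2)) with hr
  have hWi : ∀ k, Integrable (W k) P := fun k => integrable_truncatedRatio ξ _ _
  set V : Ω → ℝ := fun ω => (S.card : ℝ)⁻¹ * ∑ k ∈ S, W k ω with hV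
  have hVi : Integrable V P := (integrable_finsetSum S fun k _ => hWi k).const_mul _
  have hdata := measurable_noiseData ξ e σ
  set B : Set Ω := {ω | φ (noiseData ξ e σ ω) = 0} with hBdef
  have hB : MeasurableSet B := (hφ.comp hdata) (measurableSet_singleton 0)
  have hBc : dataLaw A ξ e σ 0 {y | φ y = 1} = P Bᶜ := by
    rw [dataLaw_zero, Measure.map_apply hdata (hφm 1)]
    congr 1
    ext ω
    simp only [hBdef, Set.mem_preimage, Set.mem_ofPred_eq, Set.mem_compl_iff]
    omega
  have hmass : 1 - r ≤ P.real Bᶜ + ∫ ω in B, V ω ∂P := by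
    have h1 : ∫ ω in B, (1 - V ω) ∂P = P.real B - ∫ ω in B, V ω ∂P := by
      rw [integral_sub (integrable_const _).integrableOn hVi.integrableOn]
      simp
    have h2 : ∫ ω in B, (1 - V ω) ∂P ≤ r := by
      have hi : Integrable (fun ω => 1 - V ω) P := (integrable_const _).sub hVi
      calc _ ≤ ∫ ω in B, |1 - V ω| ∂P :=
            integral_mono hi.integrableOn hi.abs.integrableOn fun ω => le_abs_self _
        _ ≤ ∫ ω, |1 - V ω| ∂P := setIntegral_le_integral hi.abs (ae_of_all _ fun ω => abs_nonneg _)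
        _ ≤ r := hmain
    have h3 := probReal_add_probReal_compl (μ := P) hB
    linarith
  -- Some alternative does at least as badly as the average; which one depends on the test `φ`.
  obtain ⟨k, hk, hkV⟩ : ∃ k ∈ S, ∫ ω in B, V ω ∂P ≤ ∫ ω in B, W k ω ∂P := by
    refine Finset.exists_le_of_sum_le hS ?_
    rw [Finset.sum_const, nsmul_eq_mul, integral_const_mul,
      integral_finsetSum S fun k _ => (hWi k).integrableOn, mul_inv_cancel_left₀ hn.ne']
  have hlaw : ENNReal.ofReal (∫ ω in B, W k ω ∂P) ≤ dataLaw A ξ e σ (f k) {y | φ y = 0} := by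
    rw [dataLaw_eq_map_tilted A hξ e hσ.ne' (f k),
      Measure.map_apply hdata (hφm 0),
      tilted_apply_eq_ofReal_integral, hξ.integral_exp_noiseRe]
    refine ENNReal.ofReal_le_ofReal ?_
    exact setIntegral_mono (hWi k).integrableOn
      ((hξ.integrable_exp_noiseRe (w k)).div_const _).integrableOn (truncatedRatio_le ξ _ (w k))
  calc ENNReal.ofReal (1 - r) ≤ ENNReal.ofReal (P.real Bᶜ + ∫ ω in B, W k ω ∂P) :=
        ENNReal.ofReal_le_ofReal (hmass.trans (by linarith))
    _ ≤ ENNReal.ofReal (P.real Bᶜ) + ENNReal.ofReal (∫ ω in B, W k ω ∂P) :=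
        ENNReal.ofReal_add_le
    _ ≤ _ := by
        rw [hBc, ofReal_measureReal]
        gcongr
        exact hlaw.trans (le_iSup₂_of_le (f k) (hfF k hk) le_rfl)

end

/-! ### Asymptotics and detection boundaries -/

theorem AsympLE.eventually {a b : ℝ → ℝ} (h : AsympLE a b) : ∀ᶠ σ in 𝓝[>] 0, a σ ≤ b σ := by
  obtain ⟨σ₀, h0, h⟩ := h
  filter_upwards [Ioo_mem_nhdsGT h0] with σ hσ using h σ hσ.1 hσ.2

theorem asympLE_of_eventually {a b : ℝ → ℝ} (h : ∀ᶠ σ in 𝓝[>] 0, a σ ≤ b σ) : AsympLE a b := by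
  obtain ⟨σ₀, h0, h⟩ := mem_nhdsGT_iff_exists_Ioo_subset.1 h
  exact ⟨σ₀, h0, fun σ h1 h2 => h ⟨h1, h2⟩⟩

section

variable {𝕜 : Type*} [RCLike 𝕜] {X : Type*} [NormedAddCommGroup X] [InnerProductSpace 𝕜 X]
  {Y : Type*} [NormedAddCommGroup Y] [InnerProductSpace 𝕜 Y]
  {Ω : Type*} [MeasurableSpace Ω] {P : Measure Ω} {ι : Type*}

theorem minimaxError_le_one [IsProbabilityMeasure P] (A : X →L[𝕜] Y) (ξ : Y →ₗ[𝕜] Lp 𝕜 2 P)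
    (e : HilbertBasis ℕ 𝕜 Y) (σ : ℝ) (F : Set X) : minimaxError A ξ e σ F ≤ 1 := by
  -- The test that always rejects has type I error 1 and type II error 0.
  refine (iInf₂_le (fun _ => 1) measurable_const).trans ?_
  have : IsProbabilityMeasure (dataLaw A ξ e σ 0) :=
    Measure.isProbabilityMeasure_map (measurable_observation A ξ e σ 0).aemeasurable
  simp

theorem minimaxError_mono (A : X →L[𝕜] Y) (ξ : Y →ₗ[𝕜] Lp 𝕜 2 P) (e : HilbertBasis ℕ 𝕜 Y) (σ : ℝ)
    {F G : Set X} (h : F ⊆ G) : minimaxError A ξ e σ F ≤ minimaxError A ξ e σ G :=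
  iInf₂_mono fun _ _ => add_le_add le_rfl (biSup_mono h)

theorem gammaError_anti (A : X →L[𝕜] Y) (ξ : Y →ₗ[𝕜] Lp 𝕜 2 P) (e : HilbertBasis ℕ 𝕜 Y)
    (u : ι → X) (I : ℝ → Finset ι) {μ μ' : ℝ → ℝ} {σ : ℝ} (h : μ σ ≤ μ' σ) :
    gammaError A ξ e u I μ' σ ≤ gammaError A ξ e u I μ σ := by
  refine minimaxError_mono A ξ e σ ?_
  rintro f ⟨k, hk, δ, hδ, rfl⟩
  exact ⟨k, hk, δ, h.trans hδ, rfl⟩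

theorem tendsto_gammaError_one_of_le [IsProbabilityMeasure P] {A : X →L[𝕜] Y}
    {ξ : Y →ₗ[𝕜] Lp 𝕜 2 P} {e : HilbertBasis ℕ 𝕜 Y} {u : ι → X} {I : ℝ → Finset ι} {μ : ℝ → ℝ}
    {b : ℝ → ℝ≥0∞} (hb : Tendsto b (𝓝[>] 0) (𝓝 1))
    (h : ∀ᶠ σ in 𝓝[>] 0, b σ ≤ gammaError A ξ e u I μ σ) :
    Tendsto (gammaError A ξ e u I μ) (𝓝[>] 0) (𝓝 1) :=
  tendsto_of_tendsto_of_tendsto_of_le_of_le' hb tendsto_const_nhds h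
    (Eventually.of_forall fun σ => minimaxError_le_one A ξ e σ _)

theorem exists_card_eq_maxNegCorrelated (A : X →L[𝕜] Y) (u : ι → X) (J : Finset ι) :
    ∃ S : Finset ι, S ⊆ J ∧
      (∀ k ∈ S, ∀ k' ∈ S, k ≠ k' → RCLike.re (inner 𝕜 (A (u k)) (A (u k'))) ≤ 0) ∧
      S.card = maxNegCorrelated A u J := by
  refine Nat.sSup_mem (s := {n : ℕ | ∃ S : Finset ι, S ⊆ J ∧
    (∀ k ∈ S, ∀ k' ∈ S, k ≠ k' → RCLike.re (inner 𝕜 (A (u k)) (A (u k'))) ≤ 0) ∧ S.card = n})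
    ⟨0, ∅, by simp⟩ ⟨J.card, ?_⟩
  rintro n ⟨S, hS, -, rfl⟩
  exact Finset.card_le_card hS

/-- Non-asymptotic form of the lower bound below the threshold. -/
theorem IsWhiteNoise.le_gammaError_lowerThreshold [IsProbabilityMeasure P] {A : X →L[𝕜] Y}
    {ξ : Y →ₗ[𝕜] Lp 𝕜 2 P} (hξ : IsWhiteNoise P ξ) (e : HilbertBasis ℕ 𝕜 Y) {u : ι → X}
    {I : ℝ → Finset ι} {N : ℝ → ℕ} {ε : ℝ → ℝ} {σ : ℝ} (hσ : 0 < σ)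
    (hu : ∀ k ∈ I σ, A (u k) ≠ 0) (hN : N σ = maxNegCorrelated A u (I σ)) (hN2 : 2 ≤ N σ)
    (hε0 : 0 < ε σ) (hε1 : ε σ < 1) :
    ENNReal.ofReal (1 - √(3 * Real.exp (-(ε σ * √(Real.log (N σ))) ^ 2)))
      ≤ gammaError A ξ e u I (lowerThreshold ε N) σ := by
  obtain ⟨S, hSI, hS, hcard⟩ := exists_card_eq_maxNegCorrelated A u (I σ)
  rw [← hN] at hcard
  have hlog : 0 < Real.log (N σ) := Real.log_pos (by exact_mod_cast hN2)
  set T := √(2 * Real.log (N σ)) with hT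
  have hT0 : 0 < T := Real.sqrt_pos.2 (by positivity)
  have hT2 : T ^ 2 = 2 * Real.log (N σ) := Real.sq_sqrt (by positivity)
  set t := (1 - ε σ) * T with ht
  have ht0 : 0 < t := mul_pos (by linarith) hT0
  have hm : lowerThreshold ε N σ = σ * t := by
    rw [lowerThreshold, show 2 * σ ^ 2 * Real.log (N σ) = σ ^ 2 * (2 * Real.log (N σ)) by ring,
      Real.sqrt_mul (by positivity), Real.sqrt_sq hσ.le]
    ring
  have hmain := hξ.le_minimaxError A e hσ (F := alternatives A u (I σ) (lowerThreshold ε N σ))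
    (S := S) (f := fun k => ((σ * t : ℝ) : 𝕜) • ((‖A (u k)‖⁻¹ : ℝ) : 𝕜) • u k)
    (t := t) (T := T) ht0 (by nlinarith) ?_ ?_ ?_ ?_
  · have : (T - t) ^ 2 / 2 = (ε σ * √(Real.log (N σ))) ^ 2 := by
      rw [mul_pow, Real.sq_sqrt hlog.le, ht, show T - (1 - ε σ) * T = ε σ * T by ring, mul_pow, hT2]
      ring
    rwa [neg_div, this] at hmain
  · rw [hT2, hcard, mul_div_cancel_left₀ _ two_ne_zero, Real.exp_log (by positivity)]
  · refine fun k hk => ⟨k, hSI hk, ((σ * t : ℝ) : 𝕜), ?_, rfl⟩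
    rw [hm, RCLike.norm_ofReal, abs_of_pos (by positivity)]
  · intro k hk
    have : ‖A (u k)‖ ≠ 0 := norm_ne_zero_iff.2 (hu k (hSI hk))
    rw [map_smul, map_smul, norm_smul, norm_smul, RCLike.norm_ofReal, RCLike.norm_ofReal,
      abs_of_pos (mul_pos hσ ht0), abs_of_nonneg (by positivity), inv_mul_cancel₀ this, mul_one]
  · intro k hk l hl hkl
    simp only [map_smul, inner_smul_left, inner_smul_right, RCLike.conj_ofReal,
      RCLike.re_ofReal_mul]
    have h0 := hS k hk l hl hkl
    have h1 : 0 < σ * t := mul_pos hσ ht0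
    have h2 : 0 ≤ ‖A (u k)‖⁻¹ := by positivity
    have h3 : 0 ≤ ‖A (u l)‖⁻¹ := by positivity
    exact mul_nonpos_of_nonneg_of_nonpos h1.le <| mul_nonpos_of_nonneg_of_nonpos h3 <|
      mul_nonpos_of_nonneg_of_nonpos h1.le <| mul_nonpos_of_nonneg_of_nonpos h2 h0

theorem IsWhiteNoise.tendsto_gammaError_lowerThreshold [IsProbabilityMeasure P] {A : X →L[𝕜] Y}
    {ξ : Y →ₗ[𝕜] Lp 𝕜 2 P} (hξ : IsWhiteNoise P ξ) (e : HilbertBasis ℕ 𝕜 Y) {u : ι → X}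
    {I : ℝ → Finset ι} (hu : ∀ σ, 0 < σ → ∀ k ∈ I σ, A (u k) ≠ 0)
    {N : ℝ → ℕ} (hN : ∀ σ, N σ = maxNegCorrelated A u (I σ)) (hN_top : Tendsto N (𝓝[>] 0) atTop)
    {ε : ℝ → ℝ} (hε_pos : ∀ σ, 0 < σ → 0 < ε σ) (hε_zero : Tendsto ε (𝓝[>] 0) (𝓝 0))
    (hε_top : Tendsto (fun σ => ε σ * √(Real.log (N σ))) (𝓝[>] 0) atTop) :
    Tendsto (gammaError A ξ e u I (lowerThreshold ε N)) (𝓝[>] 0) (𝓝 1) := by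
  have hb : Tendsto (fun σ => ENNReal.ofReal
      (1 - √(3 * Real.exp (-(ε σ * √(Real.log (N σ))) ^ 2)))) (𝓝[>] 0) (𝓝 1) := by
    have h1 : Tendsto (fun σ => Real.exp (-(ε σ * √(Real.log (N σ))) ^ 2)) (𝓝[>] 0) (𝓝 0) :=
      Real.tendsto_exp_neg_atTop_nhds_zero.comp ((tendsto_pow_atTop two_ne_zero).comp hε_top)
    have h2 := ENNReal.tendsto_ofReal ((tendsto_const_nhds (x := (1 : ℝ))).sub
      ((h1.const_mul 3).sqrt))
    simpa using h2
  refine tendsto_gammaError_one_of_le hb ?_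
  filter_upwards [self_mem_nhdsWithin, hN_top.eventually_ge_atTop 2,
    hε_zero.eventually (gt_mem_nhds one_pos)] with σ hσ h2 h1
  exact hξ.le_gammaError_lowerThreshold e hσ (hu σ hσ) (hN σ) h2 (hε_pos σ hσ) h1

theorem eventually_lowerThreshold_nonneg {N : ℝ → ℕ} {ε : ℝ → ℝ}
    (hε_zero : Tendsto ε (𝓝[>] 0) (𝓝 0)) : ∀ᶠ σ in 𝓝[>] 0, 0 ≤ lowerThreshold ε N σ := by
  filter_upwards [hε_zero.eventually (gt_mem_nhds one_pos)] with σ h1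
  exact mul_nonneg (by linarith) (Real.sqrt_nonneg _)

/-- A family at which the hypotheses are distinguishable lies above every family at which they
are not. -/
theorem asympLE_of_tendsto_gammaError {A : X →L[𝕜] Y} {ξ : Y →ₗ[𝕜] Lp 𝕜 2 P}
    {e : HilbertBasis ℕ 𝕜 Y} {u : ι → X} {I : ℝ → Finset ι} {L μ : ℝ → ℝ}
    (hL : Tendsto (gammaError A ξ e u I L) (𝓝[>] 0) (𝓝 1))
    (hμ : Tendsto (gammaError A ξ e u I μ) (𝓝[>] 0) (𝓝 0)) : AsympLE L μ := by
  refine asympLE_of_eventually ?_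
  obtain ⟨c, hc0, hc1⟩ := exists_between (zero_lt_one (α := ℝ≥0∞))
  filter_upwards [hL.eventually (lt_mem_nhds hc1), hμ.eventually (gt_mem_nhds hc0)] with σ h1 h2
  by_contra! hlt
  exact (h1.trans_le (gammaError_anti A ξ e u I hlt.le)).not_gt h2

/-- A detection boundary lies above every constant multiple `c < 1` of a family `L` at which
the hypotheses are indistinguishable. -/
theorem IsDetectionBoundary.asympLE_mul {A : X →L[𝕜] Y} {ξ : Y →ₗ[𝕜] Lp 𝕜 2 P}
    {e : HilbertBasis ℕ 𝕜 Y} {u : ι → X} {I : ℝ → Finset ι} {L μstar : ℝ → ℝ}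
    (hb : IsDetectionBoundary A ξ e u I μstar)
    (hL : Tendsto (gammaError A ξ e u I L) (𝓝[>] 0) (𝓝 1))
    (hL0 : ∀ᶠ σ in 𝓝[>] 0, 0 ≤ L σ) {c : ℝ} (hc : c < 1) :
    AsympLE (fun σ => c * L σ) μstar := by
  obtain ⟨-, μL, μU, hL_nonneg, hU_nonneg, hU, -, hratio, hLs, -⟩ := hb
  -- `μU` is itself an admissible family above `μU`, so `γ → 0` along it and `L` is eventually below
  -- it.
  have hLU := (asympLE_of_tendsto_gammaError hL
    (hU μU hU_nonneg (asympLE_of_eventually (Eventually.of_forall fun _ => le_rfl)))).eventually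
  refine asympLE_of_eventually ?_
  filter_upwards [self_mem_nhdsWithin, hL0, hLU, hLs.eventually,
    hratio.eventually (lt_mem_nhds (max_lt hc one_pos))] with σ hσ h0 h1 h2 h3
  -- Division by zero gives 0, so a ratio exceeding `max c 0` rules out `μU σ = 0`.
  have hU0 : 0 < μU σ := by
    refine (hU_nonneg σ hσ).lt_of_ne fun h => ?_
    rw [← h, div_zero] at h3
    exact (le_max_right c 0).not_gt h3
  rw [lt_div_iff₀ hU0] at h3
  calc c * L σ ≤ max c 0 * L σ := mul_le_mul_of_nonneg_right (le_max_left _ _) h0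
    _ ≤ max c 0 * μU σ := mul_le_mul_of_nonneg_left h1 (le_max_right _ _)
    _ ≤ μL σ := h3.le
    _ ≤ μstar σ := h2

/-- The maximum of a detection boundary and a family at which the hypotheses are
indistinguishable is again a detection boundary. -/
theorem IsDetectionBoundary.max [IsProbabilityMeasure P] {A : X →L[𝕜] Y} {ξ : Y →ₗ[𝕜] Lp 𝕜 2 P}
    {e : HilbertBasis ℕ 𝕜 Y} {u : ι → X} {I : ℝ → Finset ι} {L μstar : ℝ → ℝ}
    (hb : IsDetectionBoundary A ξ e u I μstar)
    (hL : Tendsto (gammaError A ξ e u I L) (𝓝[>] 0) (𝓝 1)) :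
    IsDetectionBoundary A ξ e u I (fun σ => max (μstar σ) (L σ)) := by
  obtain ⟨hs, μL, μU, hL_nonneg, hU_nonneg, hU, hLow, hratio, hLs, hsU⟩ := hb
  have hLU := (asympLE_of_tendsto_gammaError hL
    (hU μU hU_nonneg (asympLE_of_eventually (Eventually.of_forall fun _ => le_rfl)))).eventually
  have hμL := hLow μL hL_nonneg (asympLE_of_eventually (Eventually.of_forall fun _ => le_rfl))
  refine ⟨fun σ hσ => le_max_of_le_left (hs σ hσ), fun σ => Max.max (μL σ) (L σ), μU,
    fun σ hσ => le_max_of_le_left (hL_nonneg σ hσ), hU_nonneg, hU, fun μ _ hμ => ?_, ?_, ?_, ?_⟩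
  · refine tendsto_gammaError_one_of_le (b := fun σ => min (gammaError A ξ e u I μL σ)
      (gammaError A ξ e u I L σ)) (by simpa using hμL.min hL) ?_
    filter_upwards [hμ.eventually] with σ hσ
    rcases le_max_iff.1 hσ with h | h
    · exact min_le_of_left_le (gammaError_anti A ξ e u I h)
    · exact min_le_of_right_le (gammaError_anti A ξ e u I h)
  -- The new ratio lies between `μL / μU` and `max (μL / μU) 1`, because `L ≤ μU` eventually.
  · refine tendsto_of_tendsto_of_tendsto_of_le_of_le' hratio
      (by simpa using hratio.max (tendsto_const_nhds (x := (1 : ℝ)))) ?_ ?_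
    · filter_upwards [self_mem_nhdsWithin] with σ hσ
      exact div_le_div_of_nonneg_right (le_max_left _ _) (hU_nonneg σ hσ)
    · filter_upwards [self_mem_nhdsWithin, hLU] with σ hσ h
      rw [← max_div_div_right (hU_nonneg σ hσ)]
      exact max_le_max le_rfl (div_le_one_of_le₀ h (hU_nonneg σ hσ))
  · refine asympLE_of_eventually ?_
    filter_upwards [hLs.eventually] with σ h using max_le_max h le_rfl
  · refine asympLE_of_eventually ?_
    filter_upwards [hsU.eventually, hLU] with σ h h' using max_le h h'

end

end SignalDetection

theorem theorem3p2 {𝕜 : Type*} [RCLike 𝕜]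
    {X : Type*} [NormedAddCommGroup X] [InnerProductSpace 𝕜 X] [CompleteSpace X]
    {Y : Type*} [NormedAddCommGroup Y] [InnerProductSpace 𝕜 Y] [CompleteSpace Y]
    {Ω : Type*} [MeasurableSpace Ω] (P : Measure Ω) [IsProbabilityMeasure P]
    (A : X →L[𝕜] Y) (ξ : Y →ₗ[𝕜] Lp 𝕜 2 P) (hξ : SignalDetection.IsWhiteNoise P ξ)
    (e : HilbertBasis ℕ 𝕜 Y)
    {ι : Type*} [Countable ι] (u : ι → X) (I : ℝ → Finset ι)
    (hu : ∀ σ, 0 < σ → ∀ k ∈ I σ, A (u k) ≠ 0)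
    (N : ℝ → ℕ) (hN : ∀ σ, N σ = SignalDetection.maxNegCorrelated A u (I σ))
    (hN_top : Tendsto N (𝓝[>] 0) atTop)
    (ε : ℝ → ℝ) (hε_pos : ∀ σ, 0 < σ → 0 < ε σ)
    (hε_zero : Tendsto ε (𝓝[>] 0) (𝓝 0))
    (hε_top : Tendsto (fun σ => ε σ * √(Real.log (N σ))) (𝓝[>] 0) atTop) :
    -- below the threshold the hypothesis and the alternatives are indistinguishable
    (∀ μ : ℝ → ℝ, (∀ σ, 0 < σ → 0 ≤ μ σ) →
      SignalDetection.AsympLE μ (SignalDetection.lowerThreshold ε N) →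
      Tendsto (SignalDetection.gammaError A ξ e u I μ) (𝓝[>] 0) (𝓝 1)) ∧
    -- every family at which they are distinguishable lies above the threshold
    (∀ μ : ℝ → ℝ, (∀ σ, 0 < σ → 0 ≤ μ σ) →
      Tendsto (SignalDetection.gammaError A ξ e u I μ) (𝓝[>] 0) (𝓝 0) →
      SignalDetection.AsympLE (SignalDetection.lowerThreshold ε N) μ) ∧
    -- a detection boundary, if there is one, is asymptotically at least the threshold
    (∀ μstar : ℝ → ℝ, SignalDetection.IsDetectionBoundary A ξ e u I μstar →
      (∀ c : ℝ, c < 1 →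
        SignalDetection.AsympLE (fun σ => c * SignalDetection.lowerThreshold ε N σ) μstar) ∧
      SignalDetection.IsDetectionBoundary A ξ e u I
        (fun σ => max (μstar σ) (SignalDetection.lowerThreshold ε N σ))) := by
  have hL := hξ.tendsto_gammaError_lowerThreshold e hu hN hN_top hε_pos hε_zero hε_top
  refine ⟨fun μ _ hμ => ?_, fun μ _ hμ => ?_, fun μstar hb => ⟨fun c hc => ?_, ?_⟩⟩
  · refine SignalDetection.tendsto_gammaError_one_of_le hL ?_
    filter_upwards [hμ.eventually] with σ hσ using SignalDetection.gammaError_anti A ξ e u I hσ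
  · exact SignalDetection.asympLE_of_tendsto_gammaError hL hμ
  · exact hb.asympLE_mul hL (SignalDetection.eventually_lowerThreshold_nonneg hε_zero) hc
  · exact hb.max hL
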